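/- Let $\mathbb{S}^1=\mathbb{R}/\mathbb{Z}$ be the circle. A $C^1$ vector field on $\mathbb{S}^1$ is a function $f:\mathbb{S}^1\to\mathbb{R}$ whose corresponding $1$-periodic function on $\mathbb{R}$ is continuously differentiable; it defines the dynamical system $\dot x=f(x)$ on $\mathbb{S}^1$. Put $\|f\|_1=\sup_{\mathbb{S}^1}|f|+\sup_{\mathbb{S}^1}|f'|$. A fixed point is a zero $x_*$ of $f$, and it is hyperbolic if $f'(x_*)\neq 0$. Two systems $\dot x=f(x)$ and $\dot y=g(y)$ are topologically equivalent if there is a homeomorphism $h:\mathbb{S}^1\to\mathbb{S}^1$ that maps the orbits of the first, oriented by increasing time, onto the oriented orbits of the second; that is, for each solution $\gamma:\mathbb{R}\to\mathbb{S}^1$ of the first system there is an increasing bijection $\tau:\mathbb{R}\to\mathbb{R}$ such that $h\circ\gamma\circ\tau$ is a solution of the second. The system $\dot x=f(x)$ is $C^1$ structurally stable if there is $\varepsilon>0$ such that for every $C^1$ vector field $g$ with $\|g-f\|_1<\varepsilon$ the systems $\dot x=f(x)$ and $\dot y=g(y)$ are topologically equivalent. Theorem. Let $f$ be a $C^1$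 vector field on $\mathbb{S}^1$. Then $\dot x=f(x)$ is $C^1$ structurally stable if and only if it has finitely many fixed points, all of which are hyperbolic. -/

import Mathlib

/-- The circle `ℝ/ℤ`, that is, the unit interval with identified end points. -/
abbrev Circ : Type := UnitAddCircle

/-- A vector field on the circle, written in the coordinate `x` of `ℝ/ℤ` as a real function, is `C¹`
if the corresponding `1`-periodic function on the line is continuously differentiable. -/
def IsC1 (f : Circ → ℝ) : Prop :=
  ContDiff ℝ 1 (fun x : ℝ => f (x : Circ))

/-- The derivative of a real function on the circle. -/
noncomputable def circDeriv (f : Circ → ℝ) (p : Circ) : ℝ :=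
  deriv (fun t : ℝ => f (p + (t : Circ))) 0

/-- The `C¹`-norm `sup |f| + sup |f'|` (both suprema are finite if `f` is `C¹`). -/
noncomputable def c1Norm (f : Circ → ℝ) : ℝ :=
  (⨆ p : Circ, |f p|) + ⨆ p : Circ, |circDeriv f p|

/-- `p` is a fixed point of `ẋ = f(x)`. -/
def IsFixedPoint (f : Circ → ℝ) (p : Circ) : Prop :=
  f p = 0

/-- `p` is a hyperbolic fixed point of `ẋ = f(x)`. -/
def IsHyperbolic (f : Circ → ℝ) (p : Circ) : Prop :=
  IsFixedPoint f p ∧ circDeriv f p ≠ 0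

/-- `γ : ℝ → ℝ/ℤ` is a (global) solution of `ẋ = f(x)` on the circle: it has a lift `x : ℝ → ℝ`
with `x'(t) = f(x(t))` for all times `t`. -/
def IsSolution (f : Circ → ℝ) (γ : ℝ → Circ) : Prop :=
  ∃ x : ℝ → ℝ, (∀ t : ℝ, HasDerivAt x (f (x t : Circ)) t) ∧ ∀ t : ℝ, γ t = (x t : Circ)

/-- The homeomorphism `h` maps the oriented orbits of `ẋ = f(x)` onto the oriented orbits of
`ẏ = g(y)`: the image under `h` of each solution of the first system is, after an increasing change
of time from `ℝ` onto `ℝ`, a solution of the second. -/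
def IsTopologicalEquivalence (f g : Circ → ℝ) (h : Circ ≃ₜ Circ) : Prop :=
  ∀ γ : ℝ → Circ, IsSolution f γ → ∃ τ : ℝ ≃o ℝ, IsSolution g (fun t : ℝ => h (γ (τ t)))

/-- `ẋ = f(x)` and `ẏ = g(y)` are topologically equivalent. -/
def TopologicallyEquivalent (f g : Circ → ℝ) : Prop :=
  ∃ h : Circ ≃ₜ Circ, IsTopologicalEquivalence f g h

/-- `ẋ = f(x)` is `C¹` structurally stable: every `C¹` vector field in some `C¹`-ball around `f`
is topologically equivalent to `f`. -/
def IsStructurallyStable (f : Circ → ℝ) : Prop :=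
  ∃ ε : ℝ, 0 < ε ∧ ∀ g : Circ → ℝ, IsC1 g → c1Norm (g - f) < ε → TopologicallyEquivalent f g

/-!
Write `F` for the `1`-periodic lift of `f` to the line.

The condition suffices. A solution that is not constant increases or decreases according to the sign
of `F`, and runs through a whole component of `{F ≠ 0}` (`strictMono_and_mem_range_iff`). Therefore
any increasing homeomorphism `H` of the line that commutes with integer translations and satisfies
`sign g (H x) = sign f x` is a topological equivalence (`topologicallyEquivalent_of_sign_eq`). If the
zeros `p` of `f` are finitely many and hyperbolic, then a field `g` that is `C¹`-close to `f` has
exactly one zero `p + c(p)` close to each `p`, crossed in the same direction, and elsewhere it has the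
sign of `f`. The map `H x = x + ∑ c(p) · max(0, 1 - dist(x, p) / δ)` moves `p` to `p + c(p)`; it is
an increasing bijection because its displacement is a contraction
(`isStructurallyStable_of_hyperbolic`).

The condition is necessary. A topological equivalence maps the zeros of one field bijectively onto
those of the other (`TopologicallyEquivalent.exists_zero_iff`). By Sard's theorem some small regular
value `c` of `f` exists; the field `f - c` is close to `f` and has finitely many zeros, so a stable
`f` has finitely many zeros as well. If one of them were not hyperbolic, then multiplying `f` by a
function that vanishes near this zero would give a field that is `C¹`-close to `f` and has infinitely
many zeros (`exists_near_infinite_zeros`).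
-/

open Set Filter Topology

/-! ### Derivatives and the `C¹`-norm on the circle -/

theorem circDeriv_coe (f : Circ → ℝ) (x : ℝ) :
    circDeriv f (x : Circ) = deriv (fun y : ℝ => f (y : Circ)) x := by
  have h : (fun t : ℝ => f ((x : Circ) + (t : Circ))) =
      fun t : ℝ => (fun y : ℝ => f (y : Circ)) (x + t) := by
    funext t
    simp
  rw [circDeriv, h, deriv_comp_const_add (fun y : ℝ => f (y : Circ)), add_zero]

theorem exists_coe_eq (p : Circ) : ∃ x : ℝ, (x : Circ) = p :=
  QuotientAddGroup.mk_surjective p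

theorem IsC1.hasDerivAt {f : Circ → ℝ} (hf : IsC1 f) (x : ℝ) :
    HasDerivAt (fun y : ℝ => f (y : Circ)) (circDeriv f (x : Circ)) x := by
  rw [circDeriv_coe]
  exact (ContDiff.differentiable hf one_ne_zero x).hasDerivAt

theorem HasDerivAt.circDeriv_eq {f : Circ → ℝ} {x d : ℝ}
    (h : HasDerivAt (fun y : ℝ => f (y : Circ)) d x) : circDeriv f (x : Circ) = d := by
  rw [circDeriv_coe, h.deriv]

theorem continuous_of_continuous_coe {f : Circ → ℝ}
    (h : Continuous fun x : ℝ => f (x : Circ)) : Continuous f :=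
  isQuotientMap_quotient_mk'.continuous_iff.2 h

theorem IsC1.continuous {f : Circ → ℝ} (hf : IsC1 f) : Continuous f :=
  continuous_of_continuous_coe (ContDiff.continuous hf)

theorem IsC1.continuous_circDeriv {f : Circ → ℝ} (hf : IsC1 f) : Continuous (circDeriv f) := by
  refine continuous_of_continuous_coe ?_
  simp only [circDeriv_coe]
  exact ContDiff.continuous_deriv hf le_rfl

theorem IsC1.neg {f : Circ → ℝ} (hf : IsC1 f) : IsC1 (-f) :=
  ContDiff.neg hf

theorem IsC1.sub {f g : Circ → ℝ} (hf : IsC1 f) (hg : IsC1 g) : IsC1 (f - g) :=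
  ContDiff.sub hf hg

theorem circDeriv_sub {f g : Circ → ℝ} (hf : IsC1 f) (hg : IsC1 g) (p : Circ) :
    circDeriv (f - g) p = circDeriv f p - circDeriv g p := by
  obtain ⟨x, rfl⟩ := exists_coe_eq p
  exact HasDerivAt.circDeriv_eq ((hf.hasDerivAt x).sub (hg.hasDerivAt x))

theorem bddAbove_range_abs {u : Circ → ℝ} (hu : Continuous u) :
    BddAbove (range fun p => |u p|) :=
  (isCompact_range hu.abs).bddAbove

theorem IsC1.abs_le_c1Norm {f : Circ → ℝ} (hf : IsC1 f) (p : Circ) : |f p| ≤ c1Norm f := by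
  have h1 := le_ciSup (bddAbove_range_abs hf.continuous) p
  have h2 := le_ciSup (bddAbove_range_abs hf.continuous_circDeriv) p
  have := abs_nonneg (circDeriv f p)
  unfold c1Norm
  linarith

theorem IsC1.abs_circDeriv_le_c1Norm {f : Circ → ℝ} (hf : IsC1 f) (p : Circ) :
    |circDeriv f p| ≤ c1Norm f := by
  have h1 := le_ciSup (bddAbove_range_abs hf.continuous) p
  have h2 := le_ciSup (bddAbove_range_abs hf.continuous_circDeriv) p
  have := abs_nonneg (f p)
  unfold c1Norm
  linarith

theorem c1Norm_le {f : Circ → ℝ} {a b : ℝ} (ha : ∀ p, |f p| ≤ a) (hb : ∀ p, |circDeriv f p| ≤ b) :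
    c1Norm f ≤ a + b :=
  add_le_add (ciSup_le ha) (ciSup_le hb)

/-! ### Solutions -/

theorem IsC1.exists_lipschitzWith {f : Circ → ℝ} (hf : IsC1 f) :
    ∃ K : NNReal, LipschitzWith K fun x : ℝ => f (x : Circ) := by
  obtain ⟨K, hK⟩ := bddAbove_range_abs hf.continuous_circDeriv
  have hK' : ∀ p, |circDeriv f p| ≤ K := fun p => hK (mem_range_self p)
  have h0 : 0 ≤ K := (abs_nonneg _).trans (hK' 0)
  lift K to NNReal using h0
  refine ⟨K, lipschitzWith_of_nnnorm_deriv_le (ContDiff.differentiable hf one_ne_zero) ?_⟩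
  intro x
  rw [← circDeriv_coe, ← NNReal.coe_le_coe]
  exact hK' x

theorem eq_of_hasDerivAt {f : Circ → ℝ} (hf : IsC1 f) {x y : ℝ → ℝ}
    (hx : ∀ t, HasDerivAt x (f (x t : Circ)) t) (hy : ∀ t, HasDerivAt y (f (y t : Circ)) t)
    {t : ℝ} (h : x t = y t) : x = y := by
  obtain ⟨K, hK⟩ := hf.exists_lipschitzWith
  exact ODE_solution_unique_univ (v := fun _ x => f (x : Circ)) (s := fun _ => univ) (K := K)
    (fun _ => hK.lipschitzOnWith) (fun t => ⟨hx t, mem_univ _⟩) (fun t => ⟨hy t, mem_univ _⟩) h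

/-- A solution that meets a zero of the field is constant, by uniqueness. -/
theorem eq_const_of_zero {f : Circ → ℝ} (hf : IsC1 f) {x : ℝ → ℝ}
    (hx : ∀ t, HasDerivAt x (f (x t : Circ)) t) {t : ℝ} (h : f (x t : Circ) = 0) (s : ℝ) :
    x s = x t := by
  have hc : ∀ s, HasDerivAt (fun _ : ℝ => x t) (f (x t : Circ)) s := fun s => by
    rw [h]
    exact hasDerivAt_const s (x t)
  exact congrFun (eq_of_hasDerivAt hf hx hc (t := t) rfl) s

/-- A vector field on the circle is bounded, so the Picard–Lindelöf theorem gives a solution on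
every interval `[-T, T]`; by uniqueness these solutions fit together. -/
theorem IsC1.exists_solution {f : Circ → ℝ} (hf : IsC1 f) (x₀ : ℝ) :
    ∃ x : ℝ → ℝ, x 0 = x₀ ∧ ∀ t, HasDerivAt x (f (x t : Circ)) t := by
  obtain ⟨K, hK⟩ := hf.exists_lipschitzWith
  obtain ⟨M, hM⟩ := bddAbove_range_abs hf.continuous
  have hM' : ∀ p, |f p| ≤ M := fun p => hM (mem_range_self p)
  have h0 : 0 ≤ M := (abs_nonneg _).trans (hM' 0)
  lift M to NNReal using h0
  have key : ∀ n : ℕ, ∃ x : ℝ → ℝ, x 0 = x₀ ∧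
      ∀ t ∈ Ioo (-(n + 1 : ℝ)) (n + 1), HasDerivAt x (f (x t : Circ)) t := by
    intro n
    have hn : (0 : ℝ) ≤ n + 1 := by positivity
    have hp : IsPicardLindelof (fun _ (x : ℝ) => f (x : Circ)) (tmin := -(n + 1 : ℝ))
        (tmax := n + 1) ⟨0, neg_nonpos.2 hn, hn⟩ x₀ (M * (n + 1)) 0 M K := by
      refine IsPicardLindelof.of_time_independent (fun x _ => hM' x) hK.lipschitzOnWith ?_
      simp
    obtain ⟨x, hx0, hx⟩ := hp.exists_eq_forall_mem_Icc_hasDerivWithinAt₀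
    exact ⟨x, hx0, fun t ht =>
      (hx t (Ioo_subset_Icc_self ht)).hasDerivAt (Icc_mem_nhds ht.1 ht.2)⟩
  choose x hx0 hx using key
  have agree : ∀ m n : ℕ, m ≤ n → EqOn (x m) (x n) (Ioo (-(m + 1 : ℝ)) (m + 1)) := by
    intro m n hmn
    have hmn' : (m : ℝ) ≤ n := by exact_mod_cast hmn
    have hm : (0 : ℝ) ≤ m := by positivity
    refine ODE_solution_unique_of_mem_Ioo (v := fun _ x => f (x : Circ)) (s := fun _ => univ)
      (K := K) (t₀ := 0) (fun _ _ => hK.lipschitzOnWith) ⟨by linarith, by linarith⟩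
      (fun t ht => ⟨hx m t ht, mem_univ _⟩)
      (fun t ht => ⟨hx n t ⟨by linarith [ht.1], by linarith [ht.2]⟩, mem_univ _⟩) ?_
    rw [hx0, hx0]
  have hloc : ∀ (n : ℕ), ∀ t ∈ Ioo (-(n + 1 : ℝ)) (n + 1), x ⌊|t|⌋₊ t = x n t := by
    intro n t ht
    have h1 : |t| < n + 1 := abs_lt.2 ht
    have h2 : ⌊|t|⌋₊ ≤ n := by
      have : ⌊|t|⌋₊ < n + 1 := (Nat.floor_lt (abs_nonneg t)).2 (by exact_mod_cast h1)
      omega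
    exact agree _ n h2 (abs_lt.1 (Nat.lt_floor_add_one |t|))
  refine ⟨fun t => x ⌊|t|⌋₊ t, by simp [hx0], fun t => ?_⟩
  have ht : t ∈ Ioo (-((⌊|t|⌋₊ : ℝ) + 1)) (⌊|t|⌋₊ + 1) := abs_lt.1 (Nat.lt_floor_add_one |t|)
  exact (hx _ t ht).congr_of_eventuallyEq
    (eventually_of_mem (Ioo_mem_nhds ht.1 ht.2) fun s hs => hloc _ s hs)

/-- A solution starting where the field is positive increases, and its range is the connected
component of the start in the set where the field does not vanish: on a compact part of that
component the speed is bounded below, so the solution leaves it. -/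
theorem strictMono_and_mem_range_iff {f : Circ → ℝ} (hf : IsC1 f) {x : ℝ → ℝ}
    (hx : ∀ t, HasDerivAt x (f (x t : Circ)) t) (h : 0 < f (x 0 : Circ)) :
    StrictMono x ∧ ∀ z, z ∈ range x ↔ ∀ w ∈ uIcc (x 0) z, f (w : Circ) ≠ 0 := by
  have hxc : Continuous x := continuous_iff_continuousAt.2 fun t => (hx t).continuousAt
  have hfc : Continuous fun w : ℝ => f (w : Circ) := ContDiff.continuous hf
  have hne : ∀ t, f (x t : Circ) ≠ 0 := fun t ht => by
    rw [eq_const_of_zero hf hx ht 0, ht] at h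
    exact lt_irrefl _ h
  have hmono : StrictMono x := by
    refine strictMono_of_deriv_pos fun t => ?_
    rw [(hx t).deriv]
    by_contra hneg
    obtain ⟨s, hs⟩ := mem_range_of_exists_le_of_exists_ge (hfc.comp hxc)
      ⟨t, not_lt.1 hneg⟩ ⟨0, h.le⟩
    exact hne s hs
  refine ⟨hmono, fun z => ⟨?_, fun hz => ?_⟩⟩
  · rintro ⟨t, rfl⟩ w hw
    obtain ⟨s, -, rfl⟩ := intermediate_value_uIcc hxc.continuousOn hw
    exact hne s
  · have hpos : ∀ w ∈ uIcc (x 0) z, 0 < f (w : Circ) := by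
      intro w hw
      by_contra hneg
      obtain ⟨s, hs, hs0⟩ := intermediate_value_uIcc (a := x 0) (b := w) hfc.continuousOn
        (mem_uIcc_of_ge (not_lt.1 hneg) h.le)
      exact hz s (uIcc_subset_uIcc left_mem_uIcc hw hs) hs0
    obtain ⟨c, hc, hcz⟩ := isCompact_uIcc.exists_forall_le' hfc.continuousOn hpos
    -- A time at which the solution has left the segment from `x 0` to `z`, if it has speed `≥ c`.
    set T : ℝ := (z - x 0) / c with hT
    have hcT : c * T = z - x 0 := by rw [hT]; field_simp
    have hdiff : Differentiable ℝ x := fun t => (hx t).differentiableAt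
    rcases le_total (x 0) z with hle | hle
    · have hT0 : 0 ≤ T := div_nonneg (sub_nonneg.2 hle) hc.le
      by_contra hcon
      have hlt : x T < z := by
        by_contra hge
        exact hcon (mem_range_of_exists_le_of_exists_ge hxc ⟨0, hle⟩ ⟨T, not_lt.1 hge⟩)
      have := (convex_Icc 0 T).mul_sub_le_image_sub_of_le_deriv hxc.continuousOn
        hdiff.differentiableOn (C := c) (fun t ht => by
          rw [interior_Icc] at ht
          rw [(hx t).deriv]
          exact hcz _ (mem_uIcc_of_le (hmono.monotone ht.1.le)
            ((hmono.monotone ht.2.le).trans hlt.le))) 0 (left_mem_Icc.2 hT0) T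
          (right_mem_Icc.2 hT0) hT0
      linarith
    · have hT0 : T ≤ 0 := div_nonpos_of_nonpos_of_nonneg (sub_nonpos.2 hle) hc.le
      by_contra hcon
      have hlt : z < x T := by
        by_contra hge
        exact hcon (mem_range_of_exists_le_of_exists_ge hxc ⟨T, not_lt.1 hge⟩ ⟨0, hle⟩)
      have := (convex_Icc T 0).mul_sub_le_image_sub_of_le_deriv hxc.continuousOn
        hdiff.differentiableOn (C := c) (fun t ht => by
          rw [interior_Icc] at ht
          rw [(hx t).deriv]
          exact hcz _ (mem_uIcc_of_ge (hlt.le.trans (hmono.monotone ht.1.le))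
            (hmono.monotone ht.2.le))) T (left_mem_Icc.2 hT0) 0
          (right_mem_Icc.2 hT0) hT0
      linarith

/-- The case of a negative field, obtained by reversing time. -/
theorem strictAnti_and_mem_range_iff {f : Circ → ℝ} (hf : IsC1 f) {x : ℝ → ℝ}
    (hx : ∀ t, HasDerivAt x (f (x t : Circ)) t) (h : f (x 0 : Circ) < 0) :
    StrictAnti x ∧ ∀ z, z ∈ range x ↔ ∀ w ∈ uIcc (x 0) z, f (w : Circ) ≠ 0 := by
  have hy : ∀ t, HasDerivAt (fun t => x (-t)) ((-f) (x (-t) : Circ)) t := fun t => by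
    simpa [Function.comp_def] using! (hx (-t)).comp t (hasDerivAt_neg t)
  obtain ⟨h1, h2⟩ := strictMono_and_mem_range_iff hf.neg hy (by simpa using h)
  refine ⟨fun s t hst => by simpa using h1 (neg_lt_neg hst), fun z => ?_⟩
  have hr : range (fun t => x (-t)) = range x := (Equiv.neg ℝ).surjective.range_comp x
  rw [← hr, h2]
  simp

/-! ### Homeomorphisms close to the identity -/

theorem strictMono_add_displacement {φ : Circ → ℝ} {κ : NNReal} (hκ : κ < 1)
    (hφ : LipschitzWith κ fun x : ℝ => φ x) : StrictMono fun x : ℝ => x + φ x := by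
  intro x y hxy
  have h := hφ.dist_le_mul x y
  have hκ' : (κ : ℝ) < 1 := by exact_mod_cast hκ
  rw [Real.dist_eq, Real.dist_eq, abs_sub_comm x y, abs_of_pos (sub_pos.2 hxy)] at h
  have h1 := (abs_le.1 h).2
  have h2 : κ * (y - x) < 1 * (y - x) := mul_lt_mul_of_pos_right hκ' (sub_pos.2 hxy)
  simp only
  linarith

theorem surjective_add_displacement {φ : Circ → ℝ} {κ : NNReal} (hκ : κ < 1)
    (hφ : LipschitzWith κ fun x : ℝ => φ x) : Function.Surjective fun x : ℝ => x + φ x := by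
  intro y
  -- A preimage of `y` is a fixed point of the contraction `x ↦ y - φ x`.
  have hc : ContractingWith κ fun x : ℝ => y - φ x := by
    refine ⟨hκ, LipschitzWith.of_dist_le_mul fun a b => ?_⟩
    rw [dist_sub_left]
    exact hφ.dist_le_mul a b
  obtain ⟨x, hx⟩ : ∃ x : ℝ, y - φ x = x := ⟨_, hc.fixedPoint_isFixedPt⟩
  exact ⟨x, by simp only; linarith⟩

/-- The homeomorphism `p ↦ p + φ(p)` of the circle. -/
theorem exists_homeomorph_displacement {φ : Circ → ℝ} {κ : NNReal} (hκ : κ < 1)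
    (hφ : LipschitzWith κ fun x : ℝ => φ x) :
    ∃ h : Circ ≃ₜ Circ, ∀ x : ℝ, h (x : Circ) = ((x + φ x : ℝ) : Circ) := by
  have hφc : Continuous φ := continuous_of_continuous_coe hφ.continuous
  have hcont : Continuous fun p : Circ => p + (φ p : Circ) :=
    continuous_id.add ((AddCircle.continuous_mk' 1).comp hφc)
  have hbij : Function.Bijective fun p : Circ => p + (φ p : Circ) := by
    constructor
    · intro p q hpq
      obtain ⟨x, rfl⟩ := exists_coe_eq p
      obtain ⟨y, rfl⟩ := exists_coe_eq q
      have hpq' : ((x + φ x : ℝ) : Circ) = ((y + φ y : ℝ) : Circ) := by simpa using hpq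
      obtain ⟨n, hn⟩ := AddCircle.coe_eq_zero_iff (1 : ℝ) |>.1
        (show (((x + φ x) - (y + φ y) : ℝ) : Circ) = 0 by rw [AddCircle.coe_sub, hpq', sub_self])
      have hy : ((y + n : ℝ) : Circ) = (y : Circ) := by simp
      have hxy : x = y + n := (strictMono_add_displacement hκ hφ).injective (by
        simp only [hy]
        simp only [zsmul_eq_mul, mul_one] at hn
        linarith)
      rw [hxy, hy]
    · intro p
      obtain ⟨y, rfl⟩ := exists_coe_eq p
      obtain ⟨x, hx⟩ := surjective_add_displacement hκ hφ y
      exact ⟨x, by simp [← hx]⟩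
  exact ⟨Continuous.homeoOfEquivCompactToT2 (f := Equiv.ofBijective _ hbij) hcont,
    fun x => (AddCircle.coe_add (1 : ℝ) x (φ x)).symm⟩

/-! ### A criterion for topological equivalence -/

/-- Two strictly monotone curves of the same orientation that the increasing bijection `H` matches
in range differ by an increasing change of time. -/
theorem exists_orderIso_of_range_eq {H x y : ℝ → ℝ} (hH : StrictMono H)
    (h : StrictMono x ∧ StrictMono y ∨ StrictAnti x ∧ StrictAnti y)
    (hr : ∀ z, z ∈ range x ↔ H z ∈ range y) (hs : Function.Surjective H) :
    ∃ τ : ℝ ≃o ℝ, ∀ t, H (x (τ t)) = y t := by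
  have hex : ∀ t, ∃ s, H (x s) = y t := by
    intro t
    obtain ⟨z, hz⟩ := hs (y t)
    obtain ⟨s, rfl⟩ := (hr z).2 ⟨t, hz.symm⟩
    exact ⟨s, hz⟩
  choose τ hτ using hex
  have hmono : StrictMono τ := by
    intro s t hst
    rcases h with ⟨hx, hy⟩ | ⟨hx, hy⟩
    · rw [← (hH.comp hx).lt_iff_lt, Function.comp_apply, Function.comp_apply, hτ, hτ]
      exact hy hst
    · rw [← (hH.comp_strictAnti hx).lt_iff_gt, Function.comp_apply, Function.comp_apply, hτ, hτ]
      exact hy hst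
  have hxinj : Function.Injective x := h.elim (fun h => h.1.injective) fun h => h.1.injective
  have hsurj : Function.Surjective τ := by
    intro s
    obtain ⟨t, ht⟩ := (hr (x s)).1 (mem_range_self s)
    exact ⟨t, hxinj (hH.injective ((hτ t).trans ht))⟩
  exact ⟨hmono.orderIsoOfSurjective τ hsurj, hτ⟩

theorem ne_zero_iff_of_sign_eq {a b : ℝ} (h : SignType.sign a = SignType.sign b) :
    a ≠ 0 ↔ b ≠ 0 := by
  rw [← sign_ne_zero, h, sign_ne_zero]

/-- A homeomorphism of the circle homotopic to the identity that carries the sign of `f` to the sign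
of `g` is a topological equivalence: orbits of a field on the circle are its zeros and the
components of the complement of its zeros, oriented by the sign of the field. -/
theorem topologicallyEquivalent_of_sign_eq {f g : Circ → ℝ} (hf : IsC1 f) (hg : IsC1 g)
    {φ : Circ → ℝ} {κ : NNReal} (hκ : κ < 1) (hφ : LipschitzWith κ fun x : ℝ => φ x)
    (hsign : ∀ x : ℝ, SignType.sign (g ((x + φ x : ℝ) : Circ)) = SignType.sign (f (x : Circ))) :
    TopologicallyEquivalent f g := by
  obtain ⟨h, hh⟩ := exists_homeomorph_displacement hκ hφ
  have hmono := strictMono_add_displacement hκ hφ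
  have hsurj := surjective_add_displacement hκ hφ
  refine ⟨h, ?_⟩
  rintro γ ⟨x, hx, hγ⟩
  obtain ⟨y, hy0, hy⟩ := hg.exists_solution (x 0 + φ (x 0))
  suffices ∃ τ : ℝ ≃o ℝ, ∀ t, x (τ t) + φ (x (τ t)) = y t by
    obtain ⟨τ, hτ⟩ := this
    exact ⟨τ, y, hy, fun t => by simp only [hγ, hh, hτ]⟩
  have hs0 : SignType.sign (g (y 0 : Circ)) = SignType.sign (f (x 0 : Circ)) := by
    rw [hy0]
    exact hsign (x 0)
  by_cases h0 : f (x 0 : Circ) = 0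
  · have hg0 : g (y 0 : Circ) = 0 := by
      rwa [h0, sign_zero, sign_eq_zero_iff] at hs0
    refine ⟨OrderIso.refl ℝ, fun t => ?_⟩
    rw [OrderIso.refl_apply, eq_const_of_zero hf hx h0 t, eq_const_of_zero hg hy hg0 t, hy0]
  have hcomp : ∀ z, (∀ w ∈ uIcc (x 0) z, f (w : Circ) ≠ 0) ↔
      ∀ w ∈ uIcc (y 0) (z + φ z), g (w : Circ) ≠ 0 := by
    intro z
    rw [hy0]
    constructor
    · intro hz w hw
      obtain ⟨v, rfl⟩ := hsurj w
      rw [ne_zero_iff_of_sign_eq (hsign v)]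
      refine hz v ?_
      rcases le_total (x 0) z with hle | hle
      · rw [uIcc_of_le (hmono.monotone hle)] at hw
        exact mem_uIcc_of_le (hmono.le_iff_le.1 hw.1) (hmono.le_iff_le.1 hw.2)
      · rw [uIcc_of_ge (hmono.monotone hle)] at hw
        exact mem_uIcc_of_ge (hmono.le_iff_le.1 hw.1) (hmono.le_iff_le.1 hw.2)
    · intro hz w hw
      rw [← ne_zero_iff_of_sign_eq (hsign w)]
      refine hz _ ?_
      rcases le_total (x 0) z with hle | hle
      · rw [uIcc_of_le hle] at hw
        exact mem_uIcc_of_le (hmono.monotone hw.1) (hmono.monotone hw.2)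
      · rw [uIcc_of_ge hle] at hw
        exact mem_uIcc_of_ge (hmono.monotone hw.1) (hmono.monotone hw.2)
  rcases lt_or_gt_of_ne h0 with hneg | hpos
  · obtain ⟨hxa, hxr⟩ := strictAnti_and_mem_range_iff hf hx hneg
    obtain ⟨hya, hyr⟩ := strictAnti_and_mem_range_iff hg hy
      (by rwa [← sign_eq_neg_one_iff, hs0, sign_eq_neg_one_iff])
    exact exists_orderIso_of_range_eq hmono (Or.inr ⟨hxa, hya⟩)
      (fun z => by rw [hxr, hyr, hcomp]) hsurj
  · obtain ⟨hxa, hxr⟩ := strictMono_and_mem_range_iff hf hx hpos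
    obtain ⟨hya, hyr⟩ := strictMono_and_mem_range_iff hg hy
      (by rwa [← sign_eq_one_iff, hs0, sign_eq_one_iff])
    exact exists_orderIso_of_range_eq hmono (Or.inl ⟨hxa, hya⟩)
      (fun z => by rw [hxr, hyr, hcomp]) hsurj

/-! ### Hyperbolic zeros persist -/

/-- Near a point `P` where a differentiable function is small and its derivative has constant sign
and is large, the function has exactly one zero, close to `P`, at which it changes sign. -/
theorem exists_zero_sign_eq {G G' : ℝ → ℝ} {P k η ρ σ : ℝ} (hG : ∀ x, HasDerivAt G (G' x) x)
    (hσ : |σ| = 1) (hk : 0 < k) (hη : 0 < η) (hηρ : η < ρ)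
    (hG' : ∀ x, |x - P| < ρ → k ≤ σ * G' x) (hP : |G P| < k * η) :
    ∃ q, |q - P| < η ∧
      ∀ x, |x - P| < ρ → SignType.sign (G x) = SignType.sign σ * SignType.sign (x - q) := by
  have hd : ∀ x, HasDerivAt (fun x => σ * G x) (σ * G' x) x := fun x => (hG x).const_mul σ
  have hdiff : Differentiable ℝ fun x => σ * G x := fun x => (hd x).differentiableAt
  have hI : ∀ x, |x - P| < ρ ↔ x ∈ Ioo (P - ρ) (P + ρ) := fun x => by
    rw [abs_lt, mem_Ioo]
    constructor <;> rintro ⟨h1, h2⟩ <;> constructor <;> linarith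
  have hgrow : ∀ x ∈ Ioo (P - ρ) (P + ρ), ∀ y ∈ Ioo (P - ρ) (P + ρ), x ≤ y →
      k * (y - x) ≤ σ * G y - σ * G x := by
    refine (convex_Ioo (P - ρ) (P + ρ)).mul_sub_le_image_sub_of_le_deriv
      hdiff.continuous.continuousOn hdiff.differentiableOn fun x hx => ?_
    rw [interior_Ioo, ← hI] at hx
    rw [(hd x).deriv]
    exact hG' x hx
  have hP' : |σ * G P| < k * η := by rwa [abs_mul, hσ, one_mul]
  have hPm : P ∈ Ioo (P - ρ) (P + ρ) := ⟨by linarith, by linarith⟩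
  have hl : P - η ∈ Ioo (P - ρ) (P + ρ) := ⟨by linarith, by linarith⟩
  have hr : P + η ∈ Ioo (P - ρ) (P + ρ) := ⟨by linarith, by linarith⟩
  have h1 := hgrow _ hl _ hPm (by linarith)
  have h2 := hgrow _ hPm _ hr (by linarith)
  obtain ⟨h3, h4⟩ := abs_lt.1 hP'
  obtain ⟨q, hq, hq0⟩ := intermediate_value_Ioo (a := P - η) (b := P + η) (by linarith)
    hdiff.continuous.continuousOn (show (0 : ℝ) ∈ _ from ⟨by linarith, by linarith⟩)
  have hqη : |q - P| < η := abs_lt.2 ⟨by linarith [hq.1], by linarith [hq.2]⟩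
  have hqm : q ∈ Ioo (P - ρ) (P + ρ) := (hI q).1 (hqη.trans hηρ)
  refine ⟨q, hqη, fun x hx => ?_⟩
  rw [hI] at hx
  have hσσ : SignType.sign σ * SignType.sign σ = 1 := by
    rw [← sign_mul, ← abs_mul_abs_self, hσ]
    simp
  suffices h : SignType.sign (σ * G x) = SignType.sign (x - q) by
    rw [← h, sign_mul, ← mul_assoc, hσσ, one_mul]
  simp only at hq0
  rcases lt_trichotomy x q with hxq | rfl | hxq
  · have := hgrow _ hx _ hqm hxq.le
    have := mul_pos hk (sub_pos.2 hxq)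
    rw [sign_neg (by linarith), sign_neg (by linarith)]
  · rw [hq0, sub_self]
  · have := hgrow _ hqm _ hx hxq.le
    have := mul_pos hk (sub_pos.2 hxq)
    rw [sign_pos (by linarith), sign_pos (by linarith)]

theorem dist_coe_le (x y : ℝ) : dist (x : Circ) (y : Circ) ≤ |x - y| := by
  rw [dist_eq_norm, ← AddCircle.coe_sub, UnitAddCircle.norm_eq]
  simpa using round_le (x - y) 0

/-- Any point of the circle has a lift that realizes its distance from a given point. -/
theorem exists_coe_eq_abs_sub_eq_dist (x : ℝ) (p : Circ) :
    ∃ P : ℝ, (P : Circ) = p ∧ |x - P| = dist (x : Circ) p := by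
  obtain ⟨P, rfl⟩ := exists_coe_eq p
  refine ⟨P + round (x - P), by simp, ?_⟩
  rw [dist_eq_norm, ← AddCircle.coe_sub, UnitAddCircle.norm_eq, sub_sub]

/-- The displacement `∑ c(p) · max(0, 1 - dist(·, p) / δ)`, a sum over finitely many points `p`. -/
noncomputable def tentSum (Z : Finset Circ) (c : Circ → ℝ) (δ : ℝ) (y : Circ) : ℝ :=
  ∑ p ∈ Z, c p * max 0 (1 - dist y p / δ)

theorem tent_eq_zero {δ : ℝ} (hδ : 0 < δ) {y p : Circ} (h : δ ≤ dist y p) :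
    max 0 (1 - dist y p / δ) = 0 :=
  max_eq_left (sub_nonpos.2 ((one_le_div hδ).2 h))

theorem tentSum_eq_zero {Z : Finset Circ} {c : Circ → ℝ} {δ : ℝ} (hδ : 0 < δ) {y : Circ}
    (h : ∀ p ∈ Z, δ ≤ dist y p) : tentSum Z c δ y = 0 :=
  Finset.sum_eq_zero fun p hp => by rw [tent_eq_zero hδ (h p hp), mul_zero]

theorem tentSum_self {Z : Finset Circ} {c : Circ → ℝ} {δ : ℝ} (hδ : 0 < δ) {q : Circ} (hq : q ∈ Z)
    (h : ∀ p ∈ Z, p ≠ q → δ ≤ dist q p) : tentSum Z c δ q = c q := by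
  rw [tentSum, Finset.sum_eq_single_of_mem q hq fun p hp hpq => by
    rw [tent_eq_zero hδ (h p hp hpq), mul_zero]]
  simp

theorem abs_tentSum_le {Z : Finset Circ} {c : Circ → ℝ} {δ : ℝ} (hδ : 0 < δ) (y : Circ) :
    |tentSum Z c δ y| ≤ ∑ p ∈ Z, |c p| := by
  refine (Finset.abs_sum_le_sum_abs _ _).trans (Finset.sum_le_sum fun p _ => ?_)
  rw [abs_mul]
  refine mul_le_of_le_one_right (abs_nonneg _) ?_
  rw [abs_of_nonneg (le_max_left _ _)]
  have : 0 ≤ dist y p / δ := by positivity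
  exact max_le zero_le_one (by linarith)

theorem abs_tentSum_sub_le {Z : Finset Circ} {c : Circ → ℝ} {δ : ℝ} (hδ : 0 < δ) (x y : Circ) :
    |tentSum Z c δ x - tentSum Z c δ y| ≤ (∑ p ∈ Z, |c p|) / δ * dist x y := by
  rw [tentSum, tentSum, ← Finset.sum_sub_distrib, Finset.sum_div, Finset.sum_mul]
  refine (Finset.abs_sum_le_sum_abs _ _).trans (Finset.sum_le_sum fun p _ => ?_)
  rw [← mul_sub, abs_mul, div_mul_eq_mul_div, mul_div_assoc]
  refine mul_le_mul_of_nonneg_left ?_ (abs_nonneg _)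
  refine (abs_max_sub_max_le_max _ _ _ _).trans (max_le (by rw [sub_self, abs_zero]; positivity) ?_)
  rw [sub_sub_sub_cancel_left, ← sub_div, abs_div, abs_of_pos hδ, abs_sub_comm]
  gcongr
  exact abs_dist_sub_le x y p

/-- The homeomorphism that witnesses the equivalence is `x ↦ x + φ(x)`, where `φ` is a sum of small
tents that move the zeros of `f` onto those of the nearby field. -/
theorem isStructurallyStable_of_hyperbolic {f : Circ → ℝ} (hf : IsC1 f)
    (hfin : {p : Circ | f p = 0}.Finite) (hyp : ∀ p, f p = 0 → circDeriv f p ≠ 0) :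
    IsStructurallyStable f := by
  set Z := hfin.toFinset with hZ
  have hmem : ∀ p, p ∈ Z ↔ f p = 0 := fun p => by simp [hZ]
  obtain ⟨m, hm, hmZ⟩ := hfin.isCompact.exists_forall_le' hf.continuous_circDeriv.abs.continuousOn
    (a := 0) fun p hp => abs_pos.2 (hyp p hp)
  obtain ⟨δ₂, hδ₂, hunif⟩ := Metric.uniformContinuous_iff.1
    (CompactSpace.uniformContinuous_of_continuous hf.continuous_circDeriv) (m / 4) (by positivity)
  obtain ⟨δ, hδ, rfl⟩ : ∃ δ, 0 < δ ∧ δ₂ = 2 * δ := ⟨δ₂ / 2, by positivity, by ring⟩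
  have hclosed : IsClosed {p : Circ | ∀ q ∈ Z, δ ≤ dist p q} := by
    simp only [ofPred_forall]
    exact isClosed_biInter fun q _ =>
      isClosed_le continuous_const (continuous_id.dist continuous_const)
  obtain ⟨b, hb, hbZ⟩ := hclosed.isCompact.exists_forall_le' hf.continuous.abs.continuousOn
    (a := 0) fun p hp => abs_pos.2 fun h0 => by
      have := hp p ((hmem p).2 h0)
      rw [dist_self] at this
      linarith
  -- With `|c p| ≤ η` for all zeros `p`, the displacement has Lipschitz constant `< 1`.
  set η : ℝ := δ / (Z.card + 1) with hη
  have hη0 : 0 < η := by positivity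
  have hηδ : Z.card * η < δ := by
    rw [hη, mul_div_assoc', div_lt_iff₀ (by positivity)]
    nlinarith
  have hηle : η ≤ δ := div_le_self hδ.le (by linarith [(Nat.cast_nonneg Z.card : (0 : ℝ) ≤ _)])
  refine ⟨min (m / 4) (min b (m / 4 * η)), by positivity, fun g hg hgf => ?_⟩
  obtain ⟨hε1, hε'⟩ := lt_min_iff.1 hgf
  obtain ⟨hε2, hε3⟩ := lt_min_iff.1 hε'
  have hd0 : ∀ p, |g p - f p| ≤ c1Norm (g - f) := (hg.sub hf).abs_le_c1Norm
  have hd1 : ∀ p, |circDeriv g p - circDeriv f p| ≤ c1Norm (g - f) := fun p => by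
    rw [← circDeriv_sub hg hf]
    exact (hg.sub hf).abs_circDeriv_le_c1Norm p
  -- Near a zero of `f` the derivatives of `f` and `g` have the sign of `f'` at the zero.
  have hslope : ∀ P : ℝ, f (P : Circ) = 0 → ∃ σ : ℝ, |σ| = 1 ∧ ∀ x : ℝ, |x - P| < 2 * δ →
      m / 4 ≤ σ * circDeriv f (x : Circ) ∧ m / 4 ≤ σ * circDeriv g (x : Circ) := by
    intro P hP
    have hP' := hmZ P hP
    obtain ⟨σ, hσ, hσP⟩ : ∃ σ : ℝ, |σ| = 1 ∧ σ * circDeriv f (P : Circ) = |circDeriv f P| := by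
      rcases abs_choice (circDeriv f (P : Circ)) with h | h
      · exact ⟨1, abs_one, by rw [h, one_mul]⟩
      · exact ⟨-1, by simp, by rw [h, neg_one_mul]⟩
    refine ⟨σ, hσ, fun x hx => ?_⟩
    have h1 : |σ * circDeriv f (x : Circ) - σ * circDeriv f (P : Circ)| < m / 4 := by
      rw [← mul_sub, abs_mul, hσ, one_mul]
      exact hunif ((dist_coe_le x P).trans_lt hx)
    have h2 : |σ * circDeriv g (x : Circ) - σ * circDeriv f (x : Circ)| < m / 4 := by
      rw [← mul_sub, abs_mul, hσ, one_mul]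
      exact (hd1 x).trans_lt hε1
    have := (abs_lt.1 h1).1
    have := (abs_lt.1 h2).1
    constructor <;> linarith
  have hsignf : ∀ P : ℝ, f (P : Circ) = 0 → ∃ σ : ℝ, |σ| = 1 ∧
      (∀ x : ℝ, |x - P| < 2 * δ →
        SignType.sign (f (x : Circ)) = SignType.sign σ * SignType.sign (x - P)) ∧
      ∃ q : ℝ, |q - P| < η ∧ ∀ x : ℝ, |x - P| < 2 * δ →
        SignType.sign (g (x : Circ)) = SignType.sign σ * SignType.sign (x - q) := by
    intro P hP
    obtain ⟨σ, hσ, hslope⟩ := hslope P hP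
    refine ⟨σ, hσ, ?_, ?_⟩
    · obtain ⟨q, -, hq⟩ := exists_zero_sign_eq hf.hasDerivAt hσ (by positivity : 0 < m / 4) hη0
        (by linarith : η < 2 * δ) (fun x hx => (hslope x hx).1)
        (by rw [hP, abs_zero]; positivity)
      have hPq := hq P (by rw [sub_self, abs_zero]; linarith)
      rw [hP, sign_zero, eq_comm, mul_eq_zero, sign_eq_zero_iff, sign_eq_zero_iff] at hPq
      rcases hPq with h | h
      · rw [h, abs_zero] at hσ
        norm_num at hσ
      · rwa [← sub_eq_zero.1 h] at hq
    · refine exists_zero_sign_eq hg.hasDerivAt hσ (by positivity : 0 < m / 4) hη0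
        (by linarith : η < 2 * δ) (fun x hx => (hslope x hx).2) ?_
      have := hd0 P
      rw [hP, sub_zero] at this
      exact this.trans_lt hε3
  -- Distinct zeros of `f` are far apart.
  have hsep : ∀ p ∈ Z, ∀ q ∈ Z, p ≠ q → δ ≤ dist q p := by
    intro p hp q hq hpq
    by_contra hlt
    obtain ⟨x, rfl⟩ := exists_coe_eq q
    obtain ⟨P, rfl, hP⟩ := exists_coe_eq_abs_sub_eq_dist x p
    obtain ⟨σ, hσ, h, -⟩ := hsignf P ((hmem _).1 hp)
    have hx := h x (by linarith)
    rw [(hmem _).1 hq, sign_zero, eq_comm, mul_eq_zero, sign_eq_zero_iff, sign_eq_zero_iff] at hx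
    rcases hx with h | h
    · rw [h, abs_zero] at hσ
      norm_num at hσ
    · exact hpq (by rw [sub_eq_zero.1 h])
  -- The displacement `c` of the zero `p` does not depend on the lift `P` of `p`.
  have hc : ∀ p : Circ, ∃ c : ℝ, |c| ≤ η ∧ (f p = 0 → ∀ P : ℝ, (P : Circ) = p →
      ∃ σ : ℝ, (∀ x : ℝ, |x - P| < 2 * δ →
        SignType.sign (f (x : Circ)) = SignType.sign σ * SignType.sign (x - P)) ∧
      ∀ x : ℝ, |x - P| < 2 * δ →
        SignType.sign (g (x : Circ)) = SignType.sign σ * SignType.sign (x - (P + c))) := by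
    intro p
    by_cases hp : f p = 0
    · obtain ⟨Q, rfl⟩ := exists_coe_eq p
      obtain ⟨σ, hσ, h1, q, hq, h2⟩ := hsignf Q hp
      refine ⟨q - Q, hq.le, fun _ P hPQ => ⟨σ, fun x hx => ?_, fun x hx => ?_⟩⟩
      · have hxQ : ((x - P + Q : ℝ) : Circ) = x := by simp [hPQ]
        have := h1 (x - P + Q) (by simpa using hx)
        rwa [hxQ, add_sub_cancel_right] at this
      · have hxQ : ((x - P + Q : ℝ) : Circ) = x := by simp [hPQ]
        have := h2 (x - P + Q) (by simpa using hx)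
        rwa [hxQ, show x - P + Q - q = x - (P + (q - Q)) by ring] at this
    · exact ⟨0, by simpa using hη0.le, fun h => absurd h hp⟩
  choose c hcη hc using hc
  have hsum : ∑ p ∈ Z, |c p| < δ :=
    (Finset.sum_le_card_nsmul Z _ η fun p _ => hcη p).trans_lt (by rwa [nsmul_eq_mul])
  have hsum0 : 0 ≤ ∑ p ∈ Z, |c p| := Finset.sum_nonneg fun p _ => abs_nonneg _
  have hlip : LipschitzWith (Real.toNNReal ((∑ p ∈ Z, |c p|) / δ))
      fun x : ℝ => tentSum Z c δ (x : Circ) := by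
    refine LipschitzWith.of_dist_le_mul fun x y => ?_
    rw [Real.coe_toNNReal _ (by positivity), Real.dist_eq, Real.dist_eq]
    exact (abs_tentSum_sub_le hδ _ _).trans
      (mul_le_mul_of_nonneg_left (dist_coe_le x y) (by positivity))
  have hκ : Real.toNNReal ((∑ p ∈ Z, |c p|) / δ) < 1 := by
    rw [Real.toNNReal_lt_one, div_lt_one hδ]
    exact hsum
  refine topologicallyEquivalent_of_sign_eq hf hg hκ hlip fun x => ?_
  by_cases hfar : ∀ p ∈ Z, δ ≤ dist (x : Circ) p
  · rw [tentSum_eq_zero hδ hfar, add_zero]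
    have h1 := hbZ x hfar
    have h2 := abs_lt.1 ((hd0 x).trans_lt hε2)
    rcases le_abs.1 h1 with h | h
    · rw [sign_pos (by linarith), sign_pos (by linarith)]
    · rw [sign_neg (by linarith), sign_neg (by linarith)]
  · push Not at hfar
    obtain ⟨p, hp, hxp⟩ := hfar
    obtain ⟨P, rfl, hP⟩ := exists_coe_eq_abs_sub_eq_dist x p
    obtain ⟨σ, hσf, hσg⟩ := hc P ((hmem _).1 hp) P rfl
    have hHP : P + tentSum Z c δ (P : Circ) = P + c P := by
      rw [tentSum_self hδ hp fun q hq hqP => hsep q hq P hp hqP]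
    have hmono := strictMono_add_displacement hκ hlip
    have hsmall := abs_tentSum_le (Z := Z) (c := c) hδ (x : Circ)
    rw [hσf x (by linarith), hσg _ (by
      rw [add_sub_right_comm]
      exact (abs_add_le _ _).trans_lt (by linarith)), ← hHP]
    congr 1
    rcases lt_trichotomy x P with h | rfl | h
    · rw [sign_neg (sub_neg.2 h), sign_neg (sub_neg.2 (hmono h))]
    · rw [sub_self, sub_self]
    · rw [sign_pos (sub_pos.2 h), sign_pos (sub_pos.2 (hmono h))]

/-! ### Zeros of structurally stable fields -/

/-- A lift with constant velocity `v` of a constant curve on the circle has `v = 0`. -/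
theorem eq_zero_of_hasDerivAt_of_coe_eq {x : ℝ → ℝ} {v : ℝ} {p : Circ}
    (hx : ∀ t, HasDerivAt x v t) (hp : ∀ t, (x t : Circ) = p) : v = 0 := by
  by_contra hv
  have hlin : ∀ t, HasDerivAt (fun t => x t - v * t) 0 t := fun t => by
    simpa using! (hx t).sub ((hasDerivAt_id t).const_mul v)
  have hconst := is_const_of_deriv_eq_zero (fun t => (hlin t).differentiableAt)
    (fun t => (hlin t).deriv) (1 / (2 * v)) 0
  have hhalf : x (1 / (2 * v)) = x 0 + 1 / 2 := by
    field_simp at hconst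
    linarith
  have h := (hp (1 / (2 * v))).trans (hp 0).symm
  rw [hhalf, AddCircle.coe_add, add_eq_left] at h
  -- `1 / 2` is not an integer.
  obtain ⟨n, hn⟩ := (AddCircle.coe_eq_zero_iff (1 : ℝ)).1 h
  rw [zsmul_eq_mul, mul_one] at hn
  have h1 : (2 * n : ℤ) = 1 := by
    have : (2 * n : ℝ) = 1 := by rw [hn]; norm_num
    exact_mod_cast this
  omega

/-- A topological equivalence maps constant solutions to constant solutions; it maps no other solution
to a constant one, since a solution of `g` through a zero is constant. -/
theorem TopologicallyEquivalent.exists_zero_iff {f g : Circ → ℝ} (hf : IsC1 f) (hg : IsC1 g)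
    (hfg : TopologicallyEquivalent f g) : ∃ h : Circ ≃ₜ Circ, ∀ p, f p = 0 ↔ g (h p) = 0 := by
  obtain ⟨h, hh⟩ := hfg
  refine ⟨h, fun p => ?_⟩
  obtain ⟨x₀, rfl⟩ := exists_coe_eq p
  obtain ⟨x, rfl, hx⟩ := hf.exists_solution x₀
  obtain ⟨τ, y, hy, hyx⟩ := hh (fun t => (x t : Circ)) ⟨x, hx, fun _ => rfl⟩
  simp only at hyx
  constructor
  · intro h0
    have hc : ∀ t, (y t : Circ) = h (x 0 : Circ) := fun t => by
      rw [← hyx, eq_const_of_zero hf hx h0]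
    exact eq_zero_of_hasDerivAt_of_coe_eq (fun t => hc t ▸ hy t) hc
  · intro h0
    have hy0 : g (y (τ.symm 0) : Circ) = 0 := by
      rw [← hyx, τ.apply_symm_apply, h0]
    have hc : ∀ t, (x t : Circ) = x 0 := fun t => by
      refine h.injective ?_
      have h1 := hyx (τ.symm t)
      have h2 := hyx (τ.symm 0)
      rw [τ.apply_symm_apply] at h1 h2
      rw [h1, h2, eq_const_of_zero hg hy hy0]
    exact eq_zero_of_hasDerivAt_of_coe_eq (fun t => hc t ▸ hx t) hc

theorem TopologicallyEquivalent.finite_zeros_iff {f g : Circ → ℝ} (hf : IsC1 f) (hg : IsC1 g)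
    (hfg : TopologicallyEquivalent f g) :
    {p | f p = 0}.Finite ↔ {p | g p = 0}.Finite := by
  obtain ⟨h, hh⟩ := hfg.exists_zero_iff hf hg
  have heq : {p | f p = 0} = h ⁻¹' {p | g p = 0} := ext hh
  rw [heq]
  exact ⟨fun hfin => hfin.of_preimage h.surjective, fun hfin => hfin.preimage h.injective.injOn⟩

/-- Points where the derivative does not vanish are isolated in their level set, so a regular level
of a `C¹` function on the circle is finite. -/
theorem finite_level_of_regular {f : Circ → ℝ} (hf : IsC1 f) {c : ℝ}
    (h : ∀ p, f p = c → circDeriv f p ≠ 0) : {p | f p = c}.Finite := by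
  have hfc : Continuous fun x : ℝ => f (x : Circ) := ContDiff.continuous hf
  have hfin : {x ∈ Icc (0 : ℝ) 1 | f (x : Circ) = c}.Finite := by
    by_contra hinf
    obtain ⟨x, -, hx⟩ := Set.Infinite.exists_accPt_of_subset_isCompact hinf isCompact_Icc
      (sep_subset _ _)
    rw [accPt_iff_frequently_nhdsNE] at hx
    have hfreq : ∃ᶠ y : ℝ in 𝓝[≠] x, f (y : Circ) = c := hx.mono fun y hy => hy.2
    have hxc : f (x : Circ) = c := by
      have hcl : IsClosed {y : ℝ | f (y : Circ) = c} := isClosed_eq hfc continuous_const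
      exact hcl.mem_of_frequently_of_tendsto (hfreq.filter_mono nhdsWithin_le_nhds) tendsto_id
    exact hfreq ((hf.hasDerivAt x).eventually_ne (h x hxc))
  refine (hfin.image ((↑) : ℝ → Circ)).subset fun p hp => ?_
  obtain ⟨x, hx, rfl⟩ := AddCircle.eq_coe_Ico p
  exact ⟨x, ⟨Ico_subset_Icc_self hx, hp⟩, rfl⟩

/-- Sard's theorem in dimension one. -/
theorem exists_regular_value {f : Circ → ℝ} (hf : IsC1 f) {ε : ℝ} (hε : 0 < ε) :
    ∃ c ∈ Ioo 0 ε, ∀ p, f p = c → circDeriv f p ≠ 0 := by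
  have hnull : MeasureTheory.volume
      ((fun x : ℝ => f (x : Circ)) '' {x : ℝ | circDeriv f (x : Circ) = 0}) = 0 := by
    refine MeasureTheory.addHaar_image_eq_zero_of_det_fderivWithin_eq_zero _
      (f' := fun x => ContinuousLinearMap.toSpanSingleton ℝ (circDeriv f (x : Circ)))
      (fun x _ => (hf.hasDerivAt x).hasFDerivAt.hasFDerivWithinAt) fun x hx => ?_
    have hx' : circDeriv f (x : Circ) = 0 := hx
    rw [hx', ContinuousLinearMap.toSpanSingleton_zero, ContinuousLinearMap.det]
    simp
  by_contra! hcon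
  have hsub : Ioo 0 ε ⊆
      (fun x : ℝ => f (x : Circ)) '' {x : ℝ | circDeriv f (x : Circ) = 0} := by
    intro c hc
    obtain ⟨p, hp, hp'⟩ := hcon c hc
    obtain ⟨x, rfl⟩ := exists_coe_eq p
    exact ⟨x, hp', hp⟩
  have := MeasureTheory.measure_mono_null hsub hnull
  rw [Real.volume_Ioo, ENNReal.ofReal_eq_zero] at this
  linarith

theorem IsStructurallyStable.finite_zeros {f : Circ → ℝ} (hf : IsC1 f)
    (hs : IsStructurallyStable f) : {p | f p = 0}.Finite := by
  obtain ⟨ε, hε, h⟩ := hs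
  obtain ⟨c, ⟨hc0, hcε⟩, hc⟩ := exists_regular_value hf hε
  have hg : IsC1 (fun p => f p - c) := ContDiff.sub hf contDiff_const
  have hconst : IsC1 (fun _ : Circ => -c) := contDiff_const
  have hdiff : (fun p => f p - c) - f = fun _ => -c := by
    funext p
    simp
  refine ((h _ hg ?_).finite_zeros_iff hf hg).2 ?_
  · rw [hdiff]
    refine (c1Norm_le (a := c) (b := 0) (fun p => ?_) fun p => ?_).trans_lt (by linarith)
    · rw [abs_neg, abs_of_pos hc0]
    · simp [circDeriv]
  · simpa only [sub_eq_zero] using finite_level_of_regular hf hc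

/-- A `C¹` function on the line that is `1` up to `1 / 2` and `0` from `1` on. -/
theorem exists_cutoff : ∃ (χ : ℝ → ℝ) (C : ℝ), ContDiff ℝ 1 χ ∧ (∀ s, |χ s| ≤ 1) ∧
    (∀ s ≤ 1 / 2, χ s = 1) ∧ (∀ s, 1 ≤ s → χ s = 0) ∧ ∀ s ∈ Icc (0 : ℝ) 1, |deriv χ s| ≤ C := by
  have hsm : ContDiff ℝ 1 fun s : ℝ => Real.smoothTransition (2 - 2 * s) :=
    Real.smoothTransition.contDiff.comp (by fun_prop)
  obtain ⟨C, hC⟩ := (isCompact_Icc (a := (0 : ℝ)) (b := 1)).exists_bound_of_continuousOn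
    (hsm.continuous_deriv le_rfl).continuousOn
  refine ⟨_, C, hsm, fun s => ?_, fun s hs => ?_, fun s hs => ?_, hC⟩
  · rw [abs_of_nonneg (Real.smoothTransition.nonneg _)]
    exact Real.smoothTransition.le_one _
  · exact Real.smoothTransition.one_of_one_le (by linarith)
  · exact Real.smoothTransition.zero_of_nonpos (by linarith)

/-- A non-hyperbolic zero can be flattened to an interval of zeros by a `C¹`-small perturbation:
multiply `f` by a cutoff at scale `r`. The cutoff has slope `O(1 / r)` but acts where `f = o(r)`. -/
theorem exists_near_infinite_zeros {f : Circ → ℝ} (hf : IsC1 f) {p : Circ} (hp : f p = 0)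
    (hp' : circDeriv f p = 0) {ε : ℝ} (hε : 0 < ε) :
    ∃ g, IsC1 g ∧ c1Norm (g - f) < ε ∧ {q | g q = 0}.Infinite := by
  obtain ⟨χ, C, hχ, hχ1, hχone, hχzero, hχC⟩ := exists_cutoff
  have hC : 0 ≤ C := (abs_nonneg _).trans (hχC 0 ⟨le_rfl, zero_le_one⟩)
  obtain ⟨P, rfl⟩ := exists_coe_eq p
  -- `sin² π(x - P)` is a smooth function on the circle that measures the distance from `P`.
  have hper : Function.Periodic (fun x : ℝ => Real.sin (Real.pi * (x - P)) ^ 2) 1 := by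
    intro x
    simp only
    rw [show Real.pi * (x + 1 - P) = Real.pi * (x - P) + Real.pi by ring, Real.sin_add_pi, neg_sq]
  obtain ⟨S, hS⟩ : ∃ S : Circ → ℝ, ∀ x : ℝ, S x = Real.sin (Real.pi * (x - P)) ^ 2 :=
    ⟨hper.lift, fun x => hper.lift_coe x⟩
  have hSd : ∀ x : ℝ, HasDerivAt (fun x : ℝ => S (x : Circ))
      (2 * Real.sin (Real.pi * (x - P)) * (Real.cos (Real.pi * (x - P)) * Real.pi)) x := by
    intro x
    simp only [hS]
    have h := (((hasDerivAt_id x).sub_const P).const_mul Real.pi).sin.pow 2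
    simpa using! h
  have hSc : IsC1 S := by
    unfold IsC1
    simp only [hS]
    fun_prop
  set κ : ℝ := ε / (2 * (2 + 2 * Real.pi * C)) with hκ
  have hden : 0 < 2 + 2 * Real.pi * C := by positivity
  have hκ0 : 0 < κ := by positivity
  have hκε : κ * (2 + 2 * Real.pi * C) < ε := by
    rw [hκ, div_mul_eq_mul_div, div_lt_iff₀ (by positivity)]
    nlinarith
  have hev : ∀ᶠ x : ℝ in 𝓝 P, |circDeriv f (x : Circ)| < κ := by
    refine (hf.continuous_circDeriv.comp (AddCircle.continuous_mk' 1)).abs.continuousAt.eventually_lt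
      continuousAt_const ?_
    simpa [hp'] using hκ0
  obtain ⟨ρ, hρ, hball⟩ := Metric.eventually_nhds_iff_ball.1 hev
  set r : ℝ := min 1 (ρ / 2) with hr
  have hr0 : 0 < r := by positivity
  have hr1 : r ≤ 1 := min_le_left _ _
  have hrρ : r < ρ := (min_le_right _ _).trans_lt (by linarith)
  have hr2 : 0 < r ^ 2 := by positivity
  have hfsmall : ∀ x : ℝ, |x - P| ≤ r → |f (x : Circ)| ≤ κ * r := by
    intro x hx
    have hxb : x ∈ Metric.ball P ρ := hx.trans_lt hrρ
    have := (convex_ball P ρ).norm_image_sub_le_of_norm_deriv_le (𝕜 := ℝ) (C := κ)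
      (fun y _ => (hf.hasDerivAt y).differentiableAt)
      (fun y hy => by
        rw [← circDeriv_coe]
        exact (hball y hy).le) (Metric.mem_ball_self hρ) hxb
    rw [hp, sub_zero] at this
    exact this.trans (mul_le_mul_of_nonneg_left hx hκ0.le)
  -- The cutoff lives on the arc of radius `r` around `P`.
  have hnear : ∀ q : Circ, S q ≤ r ^ 2 → ∃ x : ℝ, (x : Circ) = q ∧ |x - P| ≤ r := by
    intro q hq
    obtain ⟨x, rfl, hx⟩ := exists_coe_eq_abs_sub_eq_dist P q
    refine ⟨x, rfl, ?_⟩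
    rw [abs_sub_comm] at hx
    have hhalf : |x - P| ≤ 1 / 2 := by
      rw [hx, dist_eq_norm]
      simpa using AddCircle.norm_le_half_period (1 : ℝ) (x := (P : Circ) - x) one_ne_zero
    have habs : |Real.pi * (x - P)| = Real.pi * |x - P| := by
      rw [abs_mul, abs_of_pos Real.pi_pos]
    have hjordan := Real.mul_abs_le_abs_sin (x := Real.pi * (x - P))
      (by rw [habs]; nlinarith [Real.pi_pos])
    rw [habs, ← mul_assoc, div_mul_cancel₀ _ Real.pi_ne_zero] at hjordan
    rw [hS, sq_le_sq, abs_of_pos hr0] at hq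
    linarith [abs_nonneg (x - P)]
  have hχd : ∀ x : ℝ, HasDerivAt (fun x : ℝ => χ (S (x : Circ) / r ^ 2))
      (deriv χ (S (x : Circ) / r ^ 2) *
        (2 * Real.sin (Real.pi * (x - P)) * (Real.cos (Real.pi * (x - P)) * Real.pi) / r ^ 2)) x :=
    fun x => (hχ.differentiable one_ne_zero _).hasDerivAt.comp x ((hSd x).div_const _)
  have hgC1 : IsC1 fun q => f q - f q * χ (S q / r ^ 2) :=
    ContDiff.sub hf (ContDiff.mul hf (hχ.comp (ContDiff.div_const hSc _)))
  have hdiff : (fun q => f q - f q * χ (S q / r ^ 2)) - f = fun q => -(f q * χ (S q / r ^ 2)) := by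
    funext q
    simp
  refine ⟨_, hgC1, ?_, ?_⟩
  · rw [hdiff]
    refine (c1Norm_le (a := κ) (b := κ + κ * (C * (2 * Real.pi))) (fun q => ?_)
      fun q => ?_).trans_lt (by linarith)
    · rw [abs_neg, abs_mul]
      rcases le_or_gt (S q) (r ^ 2) with hq | hq
      · obtain ⟨x, rfl, hx⟩ := hnear q hq
        calc |f (x : Circ)| * |χ (S x / r ^ 2)| ≤ (κ * r) * 1 :=
              mul_le_mul (hfsmall x hx) (hχ1 _) (abs_nonneg _) (by positivity)
          _ ≤ κ := by nlinarith
      · rw [hχzero _ ((one_le_div hr2).2 hq.le), abs_zero, mul_zero]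
        exact hκ0.le
    · have hder : ∀ x : ℝ, HasDerivAt (fun x : ℝ => -(f (x : Circ) * χ (S (x : Circ) / r ^ 2)))
          (-(circDeriv f (x : Circ) * χ (S (x : Circ) / r ^ 2) + f (x : Circ) *
            (deriv χ (S (x : Circ) / r ^ 2) * (2 * Real.sin (Real.pi * (x - P)) *
              (Real.cos (Real.pi * (x - P)) * Real.pi) / r ^ 2)))) x :=
        fun x => ((hf.hasDerivAt x).mul (hχd x)).neg
      rcases le_or_gt (S q) (r ^ 2) with hq | hq
      · obtain ⟨x, rfl, hx⟩ := hnear q hq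
        rw [HasDerivAt.circDeriv_eq (f := fun q => -(f q * χ (S q / r ^ 2))) (hder x), abs_neg]
        refine (abs_add_le _ _).trans (add_le_add ?_ ?_)
        · rw [abs_mul]
          have h1 : |circDeriv f (x : Circ)| ≤ κ := (hball x (hx.trans_lt hrρ)).le
          simpa using mul_le_mul h1 (hχ1 (S x / r ^ 2)) (abs_nonneg _) hκ0.le
        · have hSnn : 0 ≤ S (x : Circ) := by rw [hS]; positivity
          have hχ' : |deriv χ (S (x : Circ) / r ^ 2)| ≤ C :=
            hχC _ ⟨by positivity, (div_le_one hr2).2 hq⟩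
          have hsin : |Real.sin (Real.pi * (x - P))| ≤ r := by
            rwa [hS, sq_le_sq, abs_of_pos hr0] at hq
          have hS' : |2 * Real.sin (Real.pi * (x - P)) *
              (Real.cos (Real.pi * (x - P)) * Real.pi) / r ^ 2| ≤ 2 * Real.pi / r := by
            rw [abs_div, abs_of_pos hr2, div_le_div_iff₀ hr2 hr0, abs_mul, abs_mul, abs_mul,
              abs_two, abs_of_pos Real.pi_pos]
            have hcos := Real.abs_cos_le_one (Real.pi * (x - P))
            calc 2 * |Real.sin (Real.pi * (x - P))| *
                  (|Real.cos (Real.pi * (x - P))| * Real.pi) * r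
                ≤ 2 * r * (1 * Real.pi) * r := by gcongr
              _ = 2 * Real.pi * r ^ 2 := by ring
          rw [abs_mul, abs_mul]
          calc _ ≤ (κ * r) * (C * (2 * Real.pi / r)) := by
                gcongr
                exact hfsmall x hx
            _ = κ * (C * (2 * Real.pi)) := by field_simp
      · obtain ⟨x, rfl⟩ := exists_coe_eq q
        -- The perturbation vanishes identically near a point outside the arc.
        have hz : (fun y : ℝ => -(f (y : Circ) * χ (S (y : Circ) / r ^ 2))) =ᶠ[𝓝 x] fun _ => 0 := by
          filter_upwards [(hSd x).continuousAt.eventually_const_lt hq] with y hy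
          rw [hχzero _ ((one_le_div hr2).2 (le_of_lt hy)), mul_zero, neg_zero]
        rw [HasDerivAt.circDeriv_eq (f := fun q => -(f q * χ (S q / r ^ 2)))
          ((hasDerivAt_const x (0 : ℝ)).congr_of_eventuallyEq hz), abs_zero]
        positivity
  · have hz : ∀ᶠ x : ℝ in 𝓝 P, S (x : Circ) / r ^ 2 < 1 / 2 := by
      refine ((hSd P).continuousAt.div_const _).eventually_lt continuousAt_const ?_
      simp [hS]
    obtain ⟨e, he, hez⟩ := Metric.eventually_nhds_iff_ball.1 hz
    have hinj : InjOn ((↑) : ℝ → Circ) (Ioo P (P + min e 1)) := by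
      intro x hx y hy hxy
      have hsub : ∀ z ∈ Ioo P (P + min e 1), z ∈ Ico P (P + 1) := fun z hz =>
        ⟨hz.1.le, hz.2.trans_le (by linarith [min_le_right e 1])⟩
      exact (AddCircle.coe_eq_coe_iff_of_mem_Ico (hsub x hx) (hsub y hy)).1 hxy
    refine ((Ioo_infinite (by linarith [lt_min he one_pos])).image hinj).mono ?_
    rintro _ ⟨x, hx, rfl⟩
    have hxe : x ∈ Metric.ball P e := by
      rw [Real.ball_eq_Ioo]
      exact ⟨by linarith [hx.1], hx.2.trans_le (by linarith [min_le_left e 1])⟩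
    have : χ (S (x : Circ) / r ^ 2) = 1 := hχone _ (hez x hxe).le
    simp [this]

theorem theorem1 (f : Circ → ℝ) (hf : IsC1 f) :
    IsStructurallyStable f ↔
      {p : Circ | IsFixedPoint f p}.Finite ∧ ∀ p : Circ, IsFixedPoint f p → IsHyperbolic f p := by
  constructor
  · intro hs
    have hfin : {p | f p = 0}.Finite := hs.finite_zeros hf
    refine ⟨hfin, fun p hp => ⟨hp, fun hp' => ?_⟩⟩
    obtain ⟨ε, hε, h⟩ := hs
    obtain ⟨g, hg, hgf, hinf⟩ := exists_near_infinite_zeros hf hp hp' hε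
    exact hinf (((h g hg hgf).finite_zeros_iff hf hg).1 hfin)
  · rintro ⟨hfin, hyp⟩
    exact isStructurallyStable_of_hyperbolic hf hfin fun p hp => (hyp p hp).2
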